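/- Let $T, L > 0$ and $s \ge 0$. For $r \ge 0$ let $H^r(0,L)$ be the Sobolev space of real-valued functions on $(0,L)$, i.e. the space of restrictions to $(0,L)$ of the functions of $H^r(\mathbb{R}) = \{U \in L^2(\mathbb{R};\mathbb{R}) : \|U\|_{H^r(\mathbb{R})}^2 = \int_{\mathbb{R}} (1+\xi^2)^r |\hat U(\xi)|^2 \, d\xi < \infty\}$, where $\hat U(\xi) = \int_{\mathbb{R}} U(x) e^{-2\pi i x \xi}\,dx$ is the ($L^2$) Fourier transform, with the norm $\|u\|_{H^r(0,L)} = \inf \{ \|U\|_{H^r(\mathbb{R})} : U|_{(0,L)} = u \}$; let $L^p((0,T); H^r(0,L))$ be the corresponding Bochner spaces, and let $y_x$ denote the weak derivative of $y$ in the space variable $x \in (0,L)$. If $y \in L^2((0,T); H^{s+1}(0,L))$, then $y y_x \in L^1((0,T); H^s(0,L))$, and the map $$y \in L^2((0,T); H^{s+1}(0,L)) \mapsto y y_x \in L^1((0,T); H^s(0,L))$$ is continuous. Moreover, there exists $K > 0$ (depending only on $s$, $T$ and $L$) such that, for all $y, z \in L^2((0,T); H^{s+1}(0,L))$, $$\|y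 y_x - z z_x\|_{L^1((0,T);H^s(0,L))} \le K \left( \|y\|_{L^2((0,T);H^{s+1}(0,L))} + \|z\|_{L^2((0,T);H^{s+1}(0,L))} \right) \|y - z\|_{L^2((0,T);H^{s+1}(0,L))}.$$ -/

import Mathlib

open MeasureTheory Set
open scoped FourierTransform ENNReal NNReal ContDiff SchwartzMap

noncomputable section

/-- A real-valued `L²` function on the line, seen as a complex-valued one. -/
def complexifyL2 :
    Lp ℝ 2 (volume : Measure ℝ) →L[ℝ] Lp ℂ 2 (volume : Measure ℝ) :=
  Complex.ofRealCLM.compLpL 2 volume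

/-- `H^s(ℝ)`, for real-valued functions and `s ≥ 0`. -/
def MemSobolevLine (s : ℝ≥0) (U : Lp ℝ 2 (volume : Measure ℝ)) : Prop :=
  TemperedDistribution.MemSobolev (s : ℝ) 2 (complexifyL2 U : 𝓢'(ℝ, ℂ))

/-- The function `ξ ↦ (1 + ξ²)^{s/2} Û(ξ)`. -/
def sobolevFourier (s : ℝ≥0) (U : Lp ℝ 2 (volume : Measure ℝ)) : ℝ → ℂ :=
  fun ξ => (((1 + ‖ξ‖ ^ 2) ^ ((s : ℝ) / 2) : ℝ) : ℂ) *
    (𝓕 (complexifyL2 U) : Lp ℂ 2 (volume : Measure ℝ)) ξ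

/-- The norm of `H^s(ℝ)`, that is `(∫ (1 + ξ²)^s |Û(ξ)|² dξ)^{1/2}`. -/
def sobolevLineNorm (s : ℝ≥0) (U : Lp ℝ 2 (volume : Measure ℝ)) : ℝ :=
  (eLpNorm (sobolevFourier s U) 2 volume).toReal

theorem memSobolevLine_iff (s : ℝ≥0) (U : Lp ℝ 2 (volume : Measure ℝ)) :
    MemSobolevLine s U ↔ MemLp (sobolevFourier s U) 2 volume := by
  have hpos : ∀ ξ : ℝ, 0 < 1 + ‖ξ‖ ^ 2 := fun ξ => by positivity
  have hg : (fun ξ : ℝ => (((1 + ‖ξ‖ ^ 2) ^ (-(s : ℝ) / 2) : ℝ) : ℂ)).HasTemperateGrowth := by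
    fun_prop
  have hg' : (fun ξ : ℝ => (((1 + ‖ξ‖ ^ 2) ^ ((s : ℝ) / 2) : ℝ) : ℂ)).HasTemperateGrowth := by
    fun_prop
  have hinv : ∀ ξ : ℝ, (((1 + ‖ξ‖ ^ 2) ^ ((s : ℝ) / 2) : ℝ) : ℂ) *
      (((1 + ‖ξ‖ ^ 2) ^ (-(s : ℝ) / 2) : ℝ) : ℂ) = 1 := fun ξ => by
    norm_cast
    rw [← Real.rpow_add (hpos ξ)]
    norm_num
    ring_nf
    simp
  have hb : MemLp (fun ξ : ℝ => (((1 + ‖ξ‖ ^ 2) ^ (-(s : ℝ) / 2) : ℝ) : ℂ)) ∞ volume := by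
    refine memLp_top_of_bound hg.1.continuous.aestronglyMeasurable 1 (ae_of_all _ fun ξ => ?_)
    rw [Complex.norm_real, Real.norm_eq_abs, abs_of_nonneg (by positivity)]
    refine Real.rpow_le_one_of_one_le_of_nonpos (by simpa using sq_nonneg ξ) ?_
    have := s.2
    simp only [NNReal.val_eq_coe] at this
    linarith
  have hinj : Function.Injective
      (Lp.toTemperedDistributionCLM ℂ (volume : Measure ℝ) 2) :=
    LinearMap.ker_eq_bot.mp Lp.ker_toTemperedDistributionCLM_eq_bot
  unfold MemSobolevLine
  rw [TemperedDistribution.memSobolev_iff_exists_smulLeftCLM_fourier,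
    Lp.fourier_toTemperedDistribution_eq]
  unfold sobolevFourier
  generalize (𝓕 (complexifyL2 U) : Lp ℂ 2 (volume : Measure ℝ)) = V
  constructor
  · rintro ⟨G, hG⟩
    have h1 : (hb.toLp _ • G : Lp ℂ 2 (volume : Measure ℝ)) = V := by
      apply hinj
      simp only [Lp.toTemperedDistributionCLM_apply]
      rw [Lp.toTemperedDistribution_smul_eq hg, ← hG,
        TemperedDistribution.smulLeftCLM_smulLeftCLM_apply hg' hg]
      have : ((fun ξ : ℝ => (((1 + ‖ξ‖ ^ 2) ^ ((s : ℝ) / 2) : ℝ) : ℂ)) *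
          fun ξ : ℝ => (((1 + ‖ξ‖ ^ 2) ^ (-(s : ℝ) / 2) : ℝ) : ℂ)) = fun _ => 1 := by
        funext ξ
        exact hinv ξ
      rw [this, TemperedDistribution.smulLeftCLM_const, one_smul]
    refine (Lp.memLp G).ae_eq ?_
    filter_upwards [Lp.coeFn_lpSMul (r := 2) (hb.toLp _) G, hb.coeFn_toLp] with ξ e1 e2
    rw [← h1, e1, Pi.smul_apply', e2, smul_eq_mul, ← mul_assoc, hinv, one_mul]
  · intro h
    refine ⟨h.toLp _, ?_⟩
    have h1 : V = (hb.toLp _ • h.toLp _ : Lp ℂ 2 (volume : Measure ℝ)) := by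
      apply Lp.ext
      filter_upwards [Lp.coeFn_lpSMul (r := 2) (hb.toLp _) (h.toLp _), hb.coeFn_toLp,
        h.coeFn_toLp] with ξ e1 e2 e3
      rw [e1, Pi.smul_apply', e2, e3, smul_eq_mul, ← mul_assoc,
        mul_comm (((1 + ‖ξ‖ ^ 2) ^ (-(s : ℝ) / 2) : ℝ) : ℂ), hinv, one_mul]
    have h2 : (V : 𝓢'(ℝ, ℂ)) = TemperedDistribution.smulLeftCLM ℂ
        (fun ξ : ℝ => (((1 + ‖ξ‖ ^ 2) ^ (-(s : ℝ) / 2) : ℝ) : ℂ))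
        (h.toLp _ : Lp ℂ 2 (volume : Measure ℝ)) := by
      rw [← Lp.toTemperedDistribution_smul_eq (r := 2) hg hb, ← h1]
    rw [h2, TemperedDistribution.smulLeftCLM_smulLeftCLM_apply hg hg']
    have : ((fun ξ : ℝ => (((1 + ‖ξ‖ ^ 2) ^ (-(s : ℝ) / 2) : ℝ) : ℂ)) *
        fun ξ : ℝ => (((1 + ‖ξ‖ ^ 2) ^ ((s : ℝ) / 2) : ℝ) : ℂ)) = fun _ => 1 := by
      funext ξ
      exact (mul_comm _ _).trans (hinv ξ)
    rw [this, TemperedDistribution.smulLeftCLM_const, one_smul]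

theorem sobolevFourier_add (s : ℝ≥0) (U V : Lp ℝ 2 (volume : Measure ℝ)) :
    sobolevFourier s (U + V) =ᵐ[volume] sobolevFourier s U + sobolevFourier s V := by
  have h : (𝓕 (complexifyL2 (U + V)) : Lp ℂ 2 (volume : Measure ℝ)) =
      𝓕 (complexifyL2 U) + 𝓕 (complexifyL2 V) := by
    rw [map_add, FourierTransform.fourier_add]
  filter_upwards [Lp.coeFn_add (𝓕 (complexifyL2 U) : Lp ℂ 2 (volume : Measure ℝ))
    (𝓕 (complexifyL2 V))] with ξ e
  simp only [sobolevFourier, Pi.add_apply, h, e, mul_add]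

theorem sobolevFourier_smul (s : ℝ≥0) (c : ℝ) (U : Lp ℝ 2 (volume : Measure ℝ)) :
    sobolevFourier s (c • U) =ᵐ[volume] c • sobolevFourier s U := by
  have h0 : complexifyL2 (c • U) = (c : ℂ) • complexifyL2 U := by
    rw [map_smul]
    apply Lp.ext
    filter_upwards [Lp.coeFn_smul c (complexifyL2 U),
      Lp.coeFn_smul (c : ℂ) (complexifyL2 U)] with ξ e1 e2
    rw [e1, e2]
    simp
  have h : (𝓕 (complexifyL2 (c • U)) : Lp ℂ 2 (volume : Measure ℝ)) =
      (c : ℂ) • 𝓕 (complexifyL2 U) := by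
    rw [h0, FourierTransform.fourier_smul]
  filter_upwards [Lp.coeFn_smul (c : ℂ)
    (𝓕 (complexifyL2 U) : Lp ℂ 2 (volume : Measure ℝ))] with ξ e
  simp only [sobolevFourier, Pi.smul_apply, h, e, smul_eq_mul, Complex.real_smul]
  ring

theorem MemSobolevLine.add {s : ℝ≥0} {U V : Lp ℝ 2 (volume : Measure ℝ)}
    (hU : MemSobolevLine s U) (hV : MemSobolevLine s V) : MemSobolevLine s (U + V) := by
  rw [memSobolevLine_iff] at *
  exact (hU.add hV).ae_eq (sobolevFourier_add s U V).symm

theorem MemSobolevLine.smul {s : ℝ≥0} (c : ℝ) {U : Lp ℝ 2 (volume : Measure ℝ)}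
    (hU : MemSobolevLine s U) : MemSobolevLine s (c • U) := by
  rw [memSobolevLine_iff] at *
  exact (hU.const_smul c).ae_eq (sobolevFourier_smul s c U).symm

theorem MemSobolevLine.zero (s : ℝ≥0) : MemSobolevLine s 0 := by
  have h0 : complexifyL2 0 = (0 : ℂ) • 0 := by simp
  unfold MemSobolevLine
  rw [h0, ← Lp.toTemperedDistributionCLM_apply, map_smul, zero_smul]
  exact TemperedDistribution.memSobolev_fun_zero ℝ ℂ _ 2

theorem sobolevLineNorm_add_le {s : ℝ≥0} {U V : Lp ℝ 2 (volume : Measure ℝ)}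
    (hU : MemSobolevLine s U) (hV : MemSobolevLine s V) :
    sobolevLineNorm s (U + V) ≤ sobolevLineNorm s U + sobolevLineNorm s V := by
  rw [memSobolevLine_iff] at *
  unfold sobolevLineNorm
  rw [eLpNorm_congr_ae (sobolevFourier_add s U V),
    ← ENNReal.toReal_add hU.eLpNorm_ne_top hV.eLpNorm_ne_top]
  exact ENNReal.toReal_mono (ENNReal.add_ne_top.2 ⟨hU.eLpNorm_ne_top, hV.eLpNorm_ne_top⟩)
    (eLpNorm_add_le hU.1 hV.1 (by norm_num))

theorem sobolevLineNorm_smul (s : ℝ≥0) (c : ℝ) (U : Lp ℝ 2 (volume : Measure ℝ)) :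
    sobolevLineNorm s (c • U) = |c| * sobolevLineNorm s U := by
  unfold sobolevLineNorm
  rw [eLpNorm_congr_ae (sobolevFourier_smul s c U), eLpNorm_const_smul, ENNReal.toReal_mul]
  simp

theorem norm_le_sobolevLineNorm {s : ℝ≥0} {U : Lp ℝ 2 (volume : Measure ℝ)}
    (hU : MemSobolevLine s U) : ‖U‖ ≤ sobolevLineNorm s U := by
  have h1 : ‖U‖ = ‖(𝓕 (complexifyL2 U) : Lp ℂ 2 (volume : Measure ℝ))‖ := by
    rw [Lp.norm_fourier_eq, Lp.norm_def, Lp.norm_def]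
    congr 1
    refine eLpNorm_congr_norm_ae ?_
    filter_upwards [Complex.ofRealCLM.coeFn_compLpL (p := 2) U] with x e
    simp [complexifyL2, e]
  rw [h1, Lp.norm_def, sobolevLineNorm]
  refine ENNReal.toReal_mono ((memSobolevLine_iff s U).1 hU).eLpNorm_ne_top
    (eLpNorm_mono fun ξ => ?_)
  rw [sobolevFourier, norm_mul, Complex.norm_real, Real.norm_eq_abs,
    abs_of_nonneg (by positivity)]
  exact le_mul_of_one_le_left (norm_nonneg _)
    (Real.one_le_rpow (by simpa using sq_nonneg ξ) (by positivity))

/-- Lebesgue measure on the interval `(0, L)`. -/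
abbrev intervalMeasure (L : ℝ) : Measure ℝ := volume.restrict (Ioo 0 L)

/-- Restriction of functions from the line to `(0, L)`. -/
def restrictL2 (L : ℝ) : Lp ℝ 2 (volume : Measure ℝ) →L[ℝ] Lp ℝ 2 (intervalMeasure L) :=
  LpToLpRestrictCLM ℝ ℝ ℝ volume 2 (Ioo 0 L)

/-- The functions on `(0, L)` that extend to an element of `H^s(ℝ)`. -/
def sobolevSubmodule (s : ℝ≥0) (L : ℝ) : Submodule ℝ (Lp ℝ 2 (intervalMeasure L)) where
  carrier := {u | ∃ U, MemSobolevLine s U ∧ restrictL2 L U = u}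
  add_mem' := by
    rintro _ _ ⟨U, hU, rfl⟩ ⟨V, hV, rfl⟩
    exact ⟨U + V, hU.add hV, map_add _ _ _⟩
  zero_mem' := ⟨0, MemSobolevLine.zero s, map_zero _⟩
  smul_mem' := by
    rintro c _ ⟨U, hU, rfl⟩
    exact ⟨c • U, hU.smul c, map_smul _ _ _⟩

/-- The Sobolev space `H^s(0, L)` of real-valued functions, `s ≥ 0`: the restrictions to `(0, L)`
of the elements of `H^s(ℝ)`. It is a type of its own since its norm is not that of `L²(0, L)`. -/
def SobolevInterval (s : ℝ≥0) (L : ℝ) : Type := sobolevSubmodule s L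

namespace SobolevInterval

variable {s : ℝ≥0} {L : ℝ}

instance : AddCommGroup (SobolevInterval s L) :=
  inferInstanceAs (AddCommGroup (sobolevSubmodule s L))

instance : Module ℝ (SobolevInterval s L) :=
  inferInstanceAs (Module ℝ (sobolevSubmodule s L))

/-- The inclusion of `H^s(0, L)` in `L²(0, L)`. -/
def toL2 : SobolevInterval s L →ₗ[ℝ] Lp ℝ 2 (intervalMeasure L) :=
  (sobolevSubmodule s L).subtype

theorem toL2_injective : Function.Injective (toL2 : SobolevInterval s L → _) :=
  Subtype.val_injective

/-- The elements of `H^s(ℝ)` that extend `u`. -/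
def extensions (u : SobolevInterval s L) : Set (Lp ℝ 2 (volume : Measure ℝ)) :=
  {U | MemSobolevLine s U ∧ restrictL2 L U = toL2 u}

/-- The norm of `u` is the infimum of the `H^s(ℝ)` norms of the extensions of `u`. -/
instance : Norm (SobolevInterval s L) where
  norm u := sInf (sobolevLineNorm s '' extensions u)

theorem norm_def (u : SobolevInterval s L) : ‖u‖ = sInf (sobolevLineNorm s '' extensions u) := rfl

theorem extensions_nonempty (u : SobolevInterval s L) :
    (sobolevLineNorm s '' extensions u).Nonempty :=
  let ⟨U, hU⟩ := u.2
  ⟨_, U, hU, rfl⟩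

theorem bddBelow_extensions (u : SobolevInterval s L) :
    BddBelow (sobolevLineNorm s '' extensions u) :=
  ⟨0, by rintro _ ⟨U, -, rfl⟩; exact ENNReal.toReal_nonneg⟩

theorem norm_le_of_mem_extensions {u : SobolevInterval s L} {U : Lp ℝ 2 (volume : Measure ℝ)}
    (hU : U ∈ extensions u) : ‖u‖ ≤ sobolevLineNorm s U :=
  csInf_le (bddBelow_extensions u) ⟨U, hU, rfl⟩

theorem norm_nonneg' (u : SobolevInterval s L) : 0 ≤ ‖u‖ :=
  Real.sInf_nonneg (by rintro _ ⟨U, -, rfl⟩; exact ENNReal.toReal_nonneg)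

theorem norm_smul_le' (c : ℝ) (u : SobolevInterval s L) : ‖c • u‖ ≤ |c| * ‖u‖ := by
  rcases eq_or_ne c 0 with rfl | hc
  · have h0 : (0 : Lp ℝ 2 (volume : Measure ℝ)) ∈
        extensions ((0 : ℝ) • u : SobolevInterval s L) :=
      ⟨MemSobolevLine.zero s, by simp⟩
    have h1 := norm_le_of_mem_extensions h0
    have h2 := sobolevLineNorm_smul s 0 0
    simp only [smul_zero, abs_zero, zero_mul] at h2 ⊢
    exact h1.trans h2.le
  · rw [← div_le_iff₀' (abs_pos.2 hc)]
    refine le_csInf (extensions_nonempty u) ?_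
    rintro _ ⟨U, hU, rfl⟩
    rw [div_le_iff₀' (abs_pos.2 hc), ← sobolevLineNorm_smul]
    exact norm_le_of_mem_extensions ⟨hU.1.smul c, by rw [map_smul, map_smul, hU.2]⟩

theorem norm_toL2_le (u : SobolevInterval s L) : ‖toL2 u‖ ≤ ‖u‖ := by
  refine le_csInf (extensions_nonempty u) ?_
  rintro _ ⟨U, hU, rfl⟩
  rw [← hU.2]
  exact (norm_Lp_toLp_restrict_le _ U).trans (norm_le_sobolevLineNorm hU.1)

theorem core : NormedSpace.Core ℝ (SobolevInterval s L) where
  norm_nonneg := norm_nonneg'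
  norm_smul c u := by
    refine le_antisymm (norm_smul_le' c u) ?_
    rcases eq_or_ne c 0 with rfl | hc
    · simpa using norm_nonneg' _
    · have h := norm_smul_le' c⁻¹ (c • u)
      rw [smul_smul, inv_mul_cancel₀ hc, one_smul, abs_inv] at h
      rwa [Real.norm_eq_abs, ← le_inv_mul_iff₀ (abs_pos.2 hc)]
  norm_triangle u v := by
    rw [norm_def u, norm_def v, ← sub_le_iff_le_add]
    refine le_csInf (extensions_nonempty u) ?_
    rintro _ ⟨U, hU, rfl⟩
    rw [sub_le_comm]
    refine le_csInf (extensions_nonempty v) ?_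
    rintro _ ⟨V, hV, rfl⟩
    rw [sub_le_iff_le_add']
    exact (norm_le_of_mem_extensions ⟨hU.1.add hV.1, by rw [map_add, map_add, hU.2, hV.2]⟩).trans
      (sobolevLineNorm_add_le hU.1 hV.1)
  norm_eq_zero_iff u := by
    constructor
    · intro h
      have h1 := norm_toL2_le u
      rw [h] at h1
      exact toL2_injective ((norm_le_zero_iff.1 h1).trans (map_zero toL2).symm)
    · rintro rfl
      have := norm_smul_le' (0 : ℝ) (0 : SobolevInterval s L)
      simp only [smul_zero, abs_zero, zero_mul] at this
      exact le_antisymm this (norm_nonneg' _)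

instance : NormedAddCommGroup (SobolevInterval s L) := NormedAddCommGroup.ofCore core

instance : NormedSpace ℝ (SobolevInterval s L) := NormedSpace.ofCore core

end SobolevInterval

/-- `v` is the weak derivative of `u` on `(0, L)`. -/
def HasWeakDeriv {L : ℝ} (u v : Lp ℝ 2 (intervalMeasure L)) : Prop :=
  ∀ φ : ℝ → ℝ, ContDiff ℝ ∞ φ → HasCompactSupport φ → tsupport φ ⊆ Ioo 0 L →
    ∫ x in Ioo 0 L, u x * deriv φ x = -∫ x in Ioo 0 L, v x * φ x

/-- `w = u u_x` almost everywhere on `(0, L)`, where `u_x` is the weak derivative of `u`. -/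
def IsMulWeakDeriv {L : ℝ} (u w : Lp ℝ 2 (intervalMeasure L)) : Prop :=
  ∃ u' : Lp ℝ 2 (intervalMeasure L), HasWeakDeriv u u' ∧
    ∀ᵐ x ∂intervalMeasure L, w x = u x * u' x

/-- The Bochner space `L^p((0, T); H^s(0, L))`. -/
abbrev BochnerSobolev (p : ℝ≥0∞) (T : ℝ) (s : ℝ≥0) (L : ℝ) :=
  Lp (SobolevInterval s L) p (intervalMeasure T)

end

/-!
The map is `B y = b(y, y)`, where `b(u, v) = u v_x` is a bounded bilinear map
`H^{s+1}(0, L) × H^{s+1}(0, L) → H^s(0, L)`. Once `b` is available, Hölder's inequality in time makes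
it a bounded bilinear map `L² × L² → L¹` between the Bochner spaces, and the Lipschitz estimate is
`b(y, y) - b(z, z) = b(y - z, y) + b(z, y - z)`.

The estimate for `b` is proved on the line. If `U ∈ H^{s+1}(ℝ)`, its weak derivative is real-valued
and lies in `H^s(ℝ)` (`exists_weakDeriv_memSobolevLine`), as its Fourier transform is `2πiξ Û(ξ)`.
If moreover `W ∈ H^s(ℝ)`, then `U W ∈ H^s(ℝ)` (`exists_mul_memSobolevLine`): write
`⟨ξ⟩ = (1 + ξ²)^{1/2}`. By Peetre's inequality `⟨ξ⟩^s ≤ 2^{s/2} ⟨η⟩^s ⟨ξ - η⟩^s`, the function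
`⟨ξ⟩^s (Û * Ŵ)(ξ)` is dominated by the convolution of `⟨·⟩^s |Û|` with `⟨·⟩^s |Ŵ|`. The former is in
`L¹`, because `⟨·⟩^{s+1} Û` and `⟨·⟩^{-1}` are both in `L²`, and the latter is in `L²`; Young's
inequality `L¹ * L² ⊆ L²` concludes. That `Û * Ŵ` is the `L²` Fourier transform of `U W` is checked
by testing against Schwartz functions.

To pass to `(0, L)`, restrict `U V'` for arbitrary extensions `U` of `u` and `V` of `v`. Weak
derivatives on `(0, L)` are unique, so that the restriction does not depend on the extensions: this
gives the bilinearity of `b`, and allows for taking the infimum over the extensions in the bound.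
-/

noncomputable section

/-! ### Young's inequality and Peetre's inequality -/

/-- Young's inequality `L¹ * L² ⊆ L²`, for nonnegative functions. -/
theorem lintegral_sq_lintegral_mul_sub_le {f g : ℝ → ℝ≥0∞} (hf : Measurable f)
    (hg : Measurable g) :
    ∫⁻ x, (∫⁻ y, f y * g (x - y)) ^ 2 ≤ (∫⁻ y, f y) ^ 2 * ∫⁻ x, g x ^ 2 := by
  have hsq : ∀ a : ℝ≥0∞, (a ^ (1 / 2 : ℝ)) ^ 2 = a := fun a => by
    rw [← ENNReal.rpow_natCast, ← ENNReal.rpow_mul]; norm_num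
  -- Cauchy–Schwarz for `f^{1/2} · (f^{1/2} g(x - ·))`
  have cs : ∀ x, (∫⁻ y, f y * g (x - y)) ^ 2 ≤
      (∫⁻ y, f y) * ∫⁻ y, f y * g (x - y) ^ 2 := fun x => by
    have h := ENNReal.lintegral_mul_le_Lp_mul_Lq (volume : Measure ℝ)
      (p := 2) (q := 2) (Real.HolderConjugate.two_two)
      (f := fun y => f y ^ (1 / 2 : ℝ)) (g := fun y => f y ^ (1 / 2 : ℝ) * g (x - y))
      (hf.pow_const _).aemeasurable
      ((hf.pow_const _).mul (hg.comp (measurable_const.sub measurable_id))).aemeasurable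
    have h2 := pow_le_pow_left' h 2
    simp only [Pi.mul_apply, ENNReal.rpow_ofNat] at h2
    rw [mul_pow, hsq, hsq] at h2
    simp only [mul_pow, hsq] at h2
    simpa only [← mul_assoc, ← sq, hsq] using h2
  calc ∫⁻ x, (∫⁻ y, f y * g (x - y)) ^ 2
      ≤ ∫⁻ x, (∫⁻ y, f y) * ∫⁻ y, f y * g (x - y) ^ 2 := lintegral_mono cs
    _ = (∫⁻ y, f y) * ∫⁻ x, ∫⁻ y, f y * g (x - y) ^ 2 := by
        rw [lintegral_const_mul]
        exact Measurable.lintegral_prod_right' (f := fun p : ℝ × ℝ => f p.2 * g (p.1 - p.2) ^ 2)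
          (by fun_prop)
    _ = (∫⁻ y, f y) * ∫⁻ y, f y * ∫⁻ x, g x ^ 2 := by
        rw [lintegral_lintegral_swap (by fun_prop)]
        congr 1
        refine lintegral_congr fun y => ?_
        rw [lintegral_const_mul _ (by fun_prop), lintegral_sub_right_eq_self (fun x => g x ^ 2) y]
    _ = _ := by
        rw [lintegral_mul_const _ hf, ← mul_assoc, sq]

/-- Peetre's inequality, in the form `⟨a⟩^s ≤ 2^{s/2} ⟨b⟩^s ⟨a - b⟩^s`. -/
theorem one_add_sq_rpow_le (s : ℝ≥0) (a b : ℝ) :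
    (1 + ‖a‖ ^ 2) ^ ((s : ℝ) / 2) ≤
      2 ^ ((s : ℝ) / 2) * ((1 + ‖b‖ ^ 2) ^ ((s : ℝ) / 2) * (1 + ‖a - b‖ ^ 2) ^ ((s : ℝ) / 2)) := by
  rw [← Real.mul_rpow (by positivity) (by positivity), ← Real.mul_rpow (by positivity)
    (by positivity)]
  refine Real.rpow_le_rpow (by positivity) ?_ (by positivity)
  simp only [Real.norm_eq_abs, sq_abs]
  nlinarith [sq_nonneg (a - 2 * b), mul_nonneg (sq_nonneg b) (sq_nonneg (a - b))]

/-! ### The Fourier transform on `L²` by duality with Schwartz functions -/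

theorem integral_mul_fourierL2 (φ : 𝓢(ℝ, ℂ)) (F : Lp ℂ 2 (volume : Measure ℝ)) :
    ∫ ξ, φ ξ * (𝓕 F : Lp ℂ 2 (volume : Measure ℝ)) ξ = ∫ x, 𝓕 (φ : ℝ → ℂ) x * F x := by
  have h := congrArg (fun D : 𝓢'(ℝ, ℂ) => D φ) (Lp.fourier_toTemperedDistribution_eq F)
  simp only [TemperedDistribution.fourier_apply, Lp.toTemperedDistribution_apply,
    smul_eq_mul] at h
  rw [← h]
  rfl

/-- The duality relation with Schwartz functions characterizes the `L²` Fourier transform. -/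
theorem fourierL2_eq_of_forall {F G : Lp ℂ 2 (volume : Measure ℝ)}
    (h : ∀ φ : 𝓢(ℝ, ℂ), ∫ x, 𝓕 (φ : ℝ → ℂ) x * F x = ∫ ξ, φ ξ * G ξ) :
    (𝓕 F : Lp ℂ 2 (volume : Measure ℝ)) = G := by
  have hinj : Function.Injective
      (Lp.toTemperedDistributionCLM ℂ (volume : Measure ℝ) 2) :=
    LinearMap.ker_eq_bot.mp Lp.ker_toTemperedDistributionCLM_eq_bot
  apply hinj
  ext φ
  simp only [Lp.toTemperedDistributionCLM_apply, Lp.toTemperedDistribution_apply, smul_eq_mul]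
  rw [integral_mul_fourierL2, h]

theorem integral_fourierInv_mul_eq {f g : ℝ → ℂ} (hf : Integrable f) (hg : Integrable g) :
    ∫ x, 𝓕⁻ f x * g x = ∫ x, f x * 𝓕⁻ g x := by
  have h := VectorFourier.integral_fourierIntegral_smul_eq_flip (μ := volume) (ν := volume)
    (L := -(innerₗ ℝ)) Real.continuous_fourierChar
    (by simp only [LinearMap.neg_apply, innerₗ_apply_apply]; fun_prop) hf hg
  have hflip : (-(innerₗ ℝ) : ℝ →ₗ[ℝ] ℝ →ₗ[ℝ] ℝ).flip = -(innerₗ ℝ) := by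
    ext; simp
  rw [hflip] at h
  exact h

/-- Fourier inversion: an `L²` function with integrable Fourier transform is given almost everywhere
by the inverse Fourier integral. -/
theorem ae_eq_fourierInv_of_integrable {F : Lp ℂ 2 (volume : Measure ℝ)}
    (hF : Integrable (𝓕 F : Lp ℂ 2 (volume : Measure ℝ))) :
    F =ᵐ[volume] 𝓕⁻ ((𝓕 F : Lp ℂ 2 (volume : Measure ℝ)) : ℝ → ℂ) := by
  have hc : Continuous (𝓕⁻ ((𝓕 F : Lp ℂ 2 (volume : Measure ℝ)) : ℝ → ℂ)) :=
    VectorFourier.fourierIntegral_continuous Real.continuous_fourierChar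
      (by simp only [LinearMap.neg_apply, innerₗ_apply_apply]; fun_prop) hF
  refine ae_eq_of_integral_contDiff_smul_eq ((Lp.memLp F).locallyIntegrable (by norm_num))
    hc.locallyIntegrable fun g g_smooth g_cpt => ?_
  have hg₁ : HasCompactSupport (Complex.ofRealCLM ∘ g) := g_cpt.comp_left rfl
  have hg₂ : ContDiff ℝ ∞ (Complex.ofRealCLM ∘ g) := by fun_prop
  set φ : 𝓢(ℝ, ℂ) := hg₁.toSchwartzMap hg₂ with hφ
  have h1 := integral_mul_fourierL2 (𝓕⁻ φ) F
  have h2 : 𝓕 ((𝓕⁻ φ : 𝓢(ℝ, ℂ)) : ℝ → ℂ) = φ := by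
    rw [← SchwartzMap.fourier_coe, FourierTransform.fourier_fourierInv_eq]
  rw [h2, SchwartzMap.fourierInv_coe, integral_fourierInv_mul_eq φ.integrable hF] at h1
  simpa [hφ] using h1.symm

theorem norm_fourierInv_le_integral_norm (f : ℝ → ℂ) (x : ℝ) : ‖𝓕⁻ f x‖ ≤ ∫ ξ, ‖f ξ‖ :=
  VectorFourier.norm_fourierIntegral_le_integral_norm _ _ _ _ _

/-- `𝓕 (𝓕⁻ A · W) = A * 𝓕 W` for `A ∈ L¹` and `W ∈ L²`, tested against a Schwartz function. -/
theorem integral_fourier_mul_fourierInv_mul {A : ℝ → ℂ} (hA : Integrable A)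
    (W : Lp ℂ 2 (volume : Measure ℝ)) (φ : 𝓢(ℝ, ℂ)) :
    ∫ x, 𝓕 (φ : ℝ → ℂ) x * (𝓕⁻ A x * W x) =
      ∫ ξ, φ ξ * ∫ η, A η * (𝓕 W : Lp ℂ 2 (volume : Measure ℝ)) (ξ - η) := by
  set V : Lp ℂ 2 (volume : Measure ℝ) := 𝓕 W with hV
  have hφW : Integrable (fun x => 𝓕 (φ : ℝ → ℂ) x * W x) := by
    rw [← SchwartzMap.fourier_coe]
    exact MemLp.integrable_mul (p := 2) (q := 2) ((𝓕 φ).memLp 2) (Lp.memLp W)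
  -- The duality relation for the translate `φ(· + η)`, whose Fourier transform is `e^{2πiηx} 𝓕φ`.
  have key : ∀ η, 𝓕⁻ (fun x => 𝓕 (φ : ℝ → ℂ) x * W x) η = ∫ ξ, φ ξ * V (ξ - η) := fun η => by
    have h1 := integral_mul_fourierL2 (φ.compSubConstCLM ℂ (-η)) W
    have h2 : ∀ x, 𝓕 ((φ.compSubConstCLM ℂ (-η) : 𝓢(ℝ, ℂ)) : ℝ → ℂ) x =
        𝐞 (η * x) • 𝓕 (φ : ℝ → ℂ) x := fun x => by
      have := congrFun (VectorFourier.fourierIntegral_comp_add_right Real.fourierChar volume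
        (innerₗ ℝ) (φ : ℝ → ℂ) η) x
      simp only [innerₗ_apply_apply] at this
      have e : inner ℝ η x = η * x := by simp [mul_comm]
      rw [e] at this
      refine Eq.trans ?_ this
      refine congrArg (fun f : ℝ → ℂ => 𝓕 f x) (funext fun y => ?_)
      simp
    rw [← integral_sub_right_eq_self _ η] at h1
    simp only [SchwartzMap.compSubConstCLM_apply, sub_neg_eq_add, sub_add_cancel, h2] at h1
    rw [h1, Real.fourierInv_eq]
    refine integral_congr_ae (ae_of_all _ fun x => ?_)
    simp only [smul_mul_assoc]
    simp [mul_comm]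
  -- `|φ V| ≤ |φ|² + |V|²` reduces integrability on the plane to products of integrable functions.
  have hint : Integrable (fun p : ℝ × ℝ => A p.2 * (φ p.1 * V (p.1 - p.2)))
      (volume.prod volume) := by
    have hφ2 : Integrable (fun x => ‖φ x‖ ^ 2) := (φ.memLp 2).integrable_norm_pow (by norm_num)
    have hV2 : Integrable (fun x => ‖V x‖ ^ 2) :=
      (Lp.memLp V).integrable_norm_pow (by norm_num)
    have i1 : Integrable (fun p : ℝ × ℝ => ‖φ p.1‖ ^ 2 * ‖A p.2‖) (volume.prod volume) :=
      hφ2.mul_prod hA.norm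
    have i2 : Integrable (fun p : ℝ × ℝ => ‖A p.2‖ * ‖V (p.1 - p.2)‖ ^ 2)
        (volume.prod volume) :=
      hA.norm.convolution_integrand (ContinuousLinearMap.mul ℝ ℝ) hV2
    refine (i1.add i2).mono' ?_ (ae_of_all _ fun p => ?_)
    · refine hA.1.comp_snd.mul (φ.continuous.aestronglyMeasurable.comp_fst.mul ?_)
      exact ((Lp.stronglyMeasurable V).comp_measurable
        (measurable_fst.sub measurable_snd)).aestronglyMeasurable
    · simp only [norm_mul, Pi.add_apply]
      nlinarith [mul_nonneg (norm_nonneg (A p.2)) (sq_nonneg (‖φ p.1‖ - ‖V (p.1 - p.2)‖)),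
        mul_nonneg (norm_nonneg (A p.2)) (sq_nonneg (‖φ p.1‖ )),
        mul_nonneg (norm_nonneg (A p.2)) (sq_nonneg (‖V (p.1 - p.2)‖))]
  calc ∫ x, 𝓕 (φ : ℝ → ℂ) x * (𝓕⁻ A x * W x)
      = ∫ x, 𝓕⁻ A x * (𝓕 (φ : ℝ → ℂ) x * W x) := by congr 1; ext x; ring
    _ = ∫ η, A η * ∫ ξ, φ ξ * V (ξ - η) := by
        rw [integral_fourierInv_mul_eq hA hφW]
        simp only [key]
    _ = ∫ η, ∫ ξ, A η * (φ ξ * V (ξ - η)) := by simp only [integral_const_mul]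
    _ = ∫ ξ, ∫ η, A η * (φ ξ * V (ξ - η)) := (integral_integral_swap hint).symm
    _ = _ := by
        congr 1; ext ξ
        rw [← integral_const_mul]
        congr 1; ext η
        ring

/-! ### The Sobolev weight -/

/-- The weight `⟨ξ⟩^s = (1 + ξ²)^{s/2}`, complex-valued since it multiplies Fourier transforms. -/
def sobolevWeight (s : ℝ≥0) (ξ : ℝ) : ℂ := (((1 + ‖ξ‖ ^ 2) ^ ((s : ℝ) / 2) : ℝ) : ℂ)

theorem continuous_sobolevWeight (s : ℝ≥0) : Continuous (sobolevWeight s) := by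
  unfold sobolevWeight
  refine Complex.continuous_ofReal.comp (Continuous.rpow_const (by fun_prop) fun x => ?_)
  right; positivity

theorem norm_sobolevWeight (s : ℝ≥0) (ξ : ℝ) :
    ‖sobolevWeight s ξ‖ = (1 + ‖ξ‖ ^ 2) ^ ((s : ℝ) / 2) := by
  rw [sobolevWeight, Complex.norm_real, Real.norm_eq_abs, abs_of_nonneg (by positivity)]

theorem one_le_norm_sobolevWeight (s : ℝ≥0) (ξ : ℝ) : 1 ≤ ‖sobolevWeight s ξ‖ := by
  rw [norm_sobolevWeight]
  exact Real.one_le_rpow (by simpa using sq_nonneg ξ) (by positivity)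

theorem norm_sobolevWeight_add_one (s : ℝ≥0) (ξ : ℝ) :
    ‖sobolevWeight (s + 1) ξ‖ = (1 + ‖ξ‖ ^ 2) ^ (1 / 2 : ℝ) * ‖sobolevWeight s ξ‖ := by
  rw [norm_sobolevWeight, norm_sobolevWeight, ← Real.rpow_add (by positivity)]
  congr 1
  push_cast
  ring

theorem aestronglyMeasurable_integral_mul_sub {A V : ℝ → ℂ} (hA : StronglyMeasurable A)
    (hV : StronglyMeasurable V) :
    AEStronglyMeasurable (fun ξ => ∫ η, A η * V (ξ - η)) volume := by
  refine (StronglyMeasurable.integral_prod_right' (f := fun p : ℝ × ℝ => A p.2 * V (p.1 - p.2))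
    ?_).aestronglyMeasurable
  exact (hA.comp_measurable measurable_snd).mul
    (hV.comp_measurable (measurable_fst.sub measurable_snd))

theorem eLpNorm_two_sq (f : ℝ → ℂ) : eLpNorm f 2 volume ^ 2 = ∫⁻ x, ‖f x‖ₑ ^ 2 := by
  have := eLpNorm_nnreal_pow_eq_lintegral (f := f) (μ := (volume : Measure ℝ)) (p := 2)
    two_ne_zero
  simpa using this

/-- Weighted Young inequality: `‖⟨·⟩^s (A * V)‖₂ ≤ 2^{s/2} ‖⟨·⟩^s A‖₁ ‖⟨·⟩^s V‖₂`. -/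
theorem eLpNorm_sobolevWeight_mul_integral_le (s : ℝ≥0) {A V : ℝ → ℂ}
    (hA : StronglyMeasurable A) (hV : StronglyMeasurable V) :
    eLpNorm (fun ξ => sobolevWeight s ξ * ∫ η, A η * V (ξ - η)) 2 volume ≤
      ENNReal.ofReal (2 ^ ((s : ℝ) / 2)) * eLpNorm (fun ξ => sobolevWeight s ξ * A ξ) 1 volume *
        eLpNorm (fun ξ => sobolevWeight s ξ * V ξ) 2 volume := by
  have hf : Measurable fun ξ => ‖sobolevWeight s ξ * A ξ‖ₑ :=
    ((continuous_sobolevWeight s).measurable.mul hA.measurable).enorm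
  have hg : Measurable fun ξ => ‖sobolevWeight s ξ * V ξ‖ₑ :=
    ((continuous_sobolevWeight s).measurable.mul hV.measurable).enorm
  refine (ENNReal.pow_le_pow_left_iff two_ne_zero).1 ?_
  rw [eLpNorm_two_sq, mul_pow, eLpNorm_two_sq, eLpNorm_one_eq_lintegral_enorm, mul_pow, mul_assoc]
  refine le_trans ?_ (mul_le_mul_right (lintegral_sq_lintegral_mul_sub_le hf hg) _)
  rw [← lintegral_const_mul]
  swap
  · refine Measurable.pow_const ?_ _
    exact Measurable.lintegral_prod_right' (f := fun p : ℝ × ℝ =>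
      ‖sobolevWeight s p.2 * A p.2‖ₑ * ‖sobolevWeight s (p.1 - p.2) * V (p.1 - p.2)‖ₑ)
      ((hf.comp measurable_snd).mul (hg.comp (measurable_fst.sub measurable_snd)))
  refine lintegral_mono fun ξ => ?_
  rw [← mul_pow]
  refine pow_le_pow_left' ?_ 2
  rw [← integral_const_mul, ← lintegral_const_mul' _ _ ENNReal.ofReal_ne_top]
  refine (enorm_integral_le_lintegral_enorm _).trans (lintegral_mono fun η => ?_)
  have hC : (0 : ℝ) ≤ 2 ^ ((s : ℝ) / 2) := by positivity
  rw [← enorm_mul, ← ofReal_norm, ← ofReal_norm, ← ENNReal.ofReal_mul hC]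
  refine ENNReal.ofReal_le_ofReal ?_
  have h := one_add_sq_rpow_le s ξ η
  simp only [norm_mul, norm_sobolevWeight]
  calc (1 + ‖ξ‖ ^ 2) ^ ((s : ℝ) / 2) * (‖A η‖ * ‖V (ξ - η)‖)
      ≤ _ * (‖A η‖ * ‖V (ξ - η)‖) := mul_le_mul_of_nonneg_right h (by positivity)
    _ = _ := by ring

theorem memLp_rpow_neg_half : MemLp (fun ξ : ℝ => (1 + ‖ξ‖ ^ 2) ^ (-(1 / 2) : ℝ)) 2 volume := by
  have hc : Continuous (fun ξ : ℝ => (1 + ‖ξ‖ ^ 2) ^ (-(1 / 2) : ℝ)) := by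
    refine Continuous.rpow_const (by fun_prop) fun x => ?_
    left; positivity
  rw [memLp_two_iff_integrable_sq hc.aestronglyMeasurable]
  refine integrable_inv_one_add_sq.congr (ae_of_all _ fun ξ => ?_)
  simp only
  rw [← Real.rpow_natCast (_ ^ (-(1 / 2) : ℝ)) 2, ← Real.rpow_mul (by positivity)]
  norm_num [Real.rpow_neg_one]

/-- The `L²` norm of `⟨ξ⟩⁻¹ = (1 + ξ²)^{-1/2}`, finite by `memLp_rpow_neg_half`. -/
def sobolevConst : ℝ≥0∞ := eLpNorm (fun ξ : ℝ => (1 + ‖ξ‖ ^ 2) ^ (-(1 / 2) : ℝ)) 2 volume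

/-- `‖⟨·⟩^s A‖₁ ≤ ‖⟨·⟩⁻¹‖₂ ‖⟨·⟩^{s+1} A‖₂`, by the Cauchy–Schwarz inequality. -/
theorem eLpNorm_one_sobolevWeight_mul_le (s : ℝ≥0) {A : ℝ → ℂ} (hA : StronglyMeasurable A) :
    eLpNorm (fun ξ => sobolevWeight s ξ * A ξ) 1 volume ≤
      sobolevConst * eLpNorm (fun ξ => sobolevWeight (s + 1) ξ * A ξ) 2 volume := by
  have h := eLpNorm_smul_le_mul_eLpNorm (p := 2) (q := 2) (r := 1)
    (f := fun ξ => sobolevWeight (s + 1) ξ * A ξ) (μ := (volume : Measure ℝ))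
    (((continuous_sobolevWeight _).stronglyMeasurable.mul hA).aestronglyMeasurable)
    memLp_rpow_neg_half.1
  refine le_trans (eLpNorm_mono fun ξ => ?_) h
  rw [Pi.smul_apply', norm_smul, norm_mul, norm_mul, norm_sobolevWeight_add_one,
    Real.norm_of_nonneg (by positivity), ← mul_assoc, ← mul_assoc,
    ← Real.rpow_add (by positivity)]
  norm_num

/-! ### Products and weak derivatives in the Sobolev spaces of the line -/

theorem coeFn_complexifyL2 (U : Lp ℝ 2 (volume : Measure ℝ)) :
    complexifyL2 U =ᵐ[volume] fun x => (U x : ℂ) :=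
  Complex.ofRealCLM.coeFn_compLpL U

/-- The product estimate `‖U W‖_{H^s(ℝ)} ≤ C ‖U‖_{H^{s+1}(ℝ)} ‖W‖_{H^s(ℝ)}`. -/
theorem exists_mul_memSobolevLine (s : ℝ≥0) {U W : Lp ℝ 2 (volume : Measure ℝ)}
    (hU : MemSobolevLine (s + 1) U) (hW : MemSobolevLine s W) :
    ∃ M : Lp ℝ 2 (volume : Measure ℝ), MemSobolevLine s M ∧ (M =ᵐ[volume] fun x => U x * W x) ∧
      sobolevLineNorm s M ≤ 2 ^ ((s : ℝ) / 2) * sobolevConst.toReal *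
        sobolevLineNorm (s + 1) U * sobolevLineNorm s W := by
  rw [memSobolevLine_iff] at hU hW
  set A : Lp ℂ 2 (volume : Measure ℝ) := 𝓕 (complexifyL2 U) with hA
  set V : Lp ℂ 2 (volume : Measure ℝ) := 𝓕 (complexifyL2 W) with hV
  have hAm := Lp.stronglyMeasurable A
  have hVm := Lp.stronglyMeasurable V
  have hcfin : sobolevConst ≠ ⊤ := memLp_rpow_neg_half.eLpNorm_ne_top
  have hA1 : eLpNorm (fun ξ => sobolevWeight s ξ * A ξ) 1 volume ≤
      sobolevConst * eLpNorm (sobolevFourier (s + 1) U) 2 volume :=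
    eLpNorm_one_sobolevWeight_mul_le s hAm
  have hAint : Integrable A := by
    rw [← memLp_one_iff_integrable]
    refine MemLp.of_le (g := fun ξ => sobolevWeight s ξ * A ξ) ⟨?_, hA1.trans_lt
      (ENNReal.mul_lt_top hcfin.lt_top hU.eLpNorm_lt_top)⟩ hAm.aestronglyMeasurable
      (ae_of_all _ fun ξ => ?_)
    · exact ((continuous_sobolevWeight _).stronglyMeasurable.mul hAm).aestronglyMeasurable
    · rw [norm_mul]
      exact le_mul_of_one_le_left (norm_nonneg _) (one_le_norm_sobolevWeight s ξ)
  set G : ℝ → ℂ := fun ξ => ∫ η, A η * V (ξ - η) with hG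
  have hGm : AEStronglyMeasurable G volume := aestronglyMeasurable_integral_mul_sub hAm hVm
  have hwG : eLpNorm (fun ξ => sobolevWeight s ξ * G ξ) 2 volume ≤
      ENNReal.ofReal (2 ^ ((s : ℝ) / 2)) *
        (sobolevConst * eLpNorm (sobolevFourier (s + 1) U) 2 volume) *
        eLpNorm (sobolevFourier s W) 2 volume :=
    (eLpNorm_sobolevWeight_mul_integral_le s hAm hVm).trans (by gcongr; exact le_rfl)
  have htop : ENNReal.ofReal (2 ^ ((s : ℝ) / 2)) *
        (sobolevConst * eLpNorm (sobolevFourier (s + 1) U) 2 volume) *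
        eLpNorm (sobolevFourier s W) 2 volume < ⊤ :=
    ENNReal.mul_lt_top (ENNReal.mul_lt_top ENNReal.ofReal_lt_top
      (ENNReal.mul_lt_top hcfin.lt_top hU.eLpNorm_lt_top)) hW.eLpNorm_lt_top
  have hwG2 : MemLp (fun ξ => sobolevWeight s ξ * G ξ) 2 volume :=
    ⟨(continuous_sobolevWeight s).aestronglyMeasurable.mul hGm, hwG.trans_lt htop⟩
  have hG2 : MemLp G 2 volume := hwG2.of_le hGm (ae_of_all _ fun ξ => by
    rw [norm_mul]
    exact le_mul_of_one_le_left (norm_nonneg _) (one_le_norm_sobolevWeight s ξ))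
  have hUinv := ae_eq_fourierInv_of_integrable (F := complexifyL2 U) hAint
  -- `U` is bounded by `‖Û‖₁`, so that `U W` is square integrable.
  have hUtop : MemLp U ⊤ volume := by
    refine memLp_top_of_bound (Lp.memLp U).1 (∫ ξ, ‖A ξ‖) ?_
    filter_upwards [hUinv, coeFn_complexifyL2 U] with x h1 h2
    rw [← Complex.norm_real, ← h2, h1]
    exact norm_fourierInv_le_integral_norm _ _
  have hUW : MemLp (fun x => U x * W x) 2 volume := (Lp.memLp W).mul hUtop
  have hMF : (𝓕 (complexifyL2 (hUW.toLp _)) : Lp ℂ 2 (volume : Measure ℝ)) = hG2.toLp G := by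
    refine fourierL2_eq_of_forall fun φ => ?_
    have e1 : ∫ ξ, φ ξ * hG2.toLp G ξ = ∫ ξ, φ ξ * G ξ := by
      refine integral_congr_ae ?_
      filter_upwards [hG2.coeFn_toLp] with ξ h
      rw [h]
    rw [e1, hG, ← integral_fourier_mul_fourierInv_mul hAint]
    refine integral_congr_ae ?_
    filter_upwards [coeFn_complexifyL2 (hUW.toLp _), hUW.coeFn_toLp, coeFn_complexifyL2 U,
      coeFn_complexifyL2 W, hUinv] with x h1 h2 h3 h4 h5
    rw [h1, h2, ← h5, h3, h4]
    push_cast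
    ring
  have hSF : sobolevFourier s (hUW.toLp _) =ᵐ[volume] fun ξ => sobolevWeight s ξ * G ξ := by
    filter_upwards [hG2.coeFn_toLp] with ξ h
    rw [sobolevFourier, hMF, h, sobolevWeight]
  refine ⟨hUW.toLp _, (memSobolevLine_iff _ _).2 (hwG2.ae_eq hSF.symm), hUW.coeFn_toLp, ?_⟩
  rw [sobolevLineNorm, eLpNorm_congr_ae hSF]
  refine (ENNReal.toReal_mono htop.ne hwG).trans_eq ?_
  simp only [ENNReal.toReal_mul, sobolevLineNorm]
  rw [ENNReal.toReal_ofReal (by positivity)]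
  ring

theorem fourierInv_derivCLM_apply (φ : 𝓢(ℝ, ℂ)) (ξ : ℝ) :
    (𝓕⁻ (SchwartzMap.derivCLM ℂ ℂ φ) : 𝓢(ℝ, ℂ)) ξ =
      -(2 * Real.pi * Complex.I * ξ * (𝓕⁻ φ : 𝓢(ℝ, ℂ)) ξ) := by
  have h := congrArg (fun ψ : 𝓢(ℝ, ℂ) => ψ ξ) (SchwartzMap.fourierInv_lineDerivOp_eq φ (1 : ℝ))
  have hg : (fun x : ℝ => inner ℝ x (1 : ℝ)).HasTemperateGrowth := by fun_prop
  have e : LineDeriv.lineDerivOp (1 : ℝ) φ = SchwartzMap.derivCLM ℂ ℂ φ := by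
    ext x
    rw [SchwartzMap.derivCLM_apply, SchwartzMap.lineDerivOp_apply_eq_fderiv,
      fderiv_apply_one_eq_deriv]
  rw [e] at h
  simp only [neg_apply, smul_apply, neg_smul,
    SchwartzMap.smulLeftCLM_apply_apply hg] at h
  rw [h]
  simp
  ring

/-- Differentiation costs one power of the weight: `⟨ξ⟩^s |2πiξ z| ≤ 2π ⟨ξ⟩^{s+1} |z|`. -/
theorem norm_two_pi_mul_le (s : ℝ≥0) (ξ : ℝ) (z : ℂ) :
    ‖sobolevWeight s ξ * (2 * Real.pi * Complex.I * ξ * z)‖ ≤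
      2 * Real.pi * ‖sobolevWeight (s + 1) ξ * z‖ := by
  have h : |ξ| ≤ (1 + ‖ξ‖ ^ 2) ^ (1 / 2 : ℝ) := by
    rw [← Real.sqrt_eq_rpow]
    exact Real.abs_le_sqrt (by simp)
  simp only [norm_mul, norm_sobolevWeight_add_one, Complex.norm_real, Complex.norm_I,
    Complex.norm_ofNat, Real.norm_of_nonneg Real.pi_pos.le, Real.norm_eq_abs] at h ⊢
  have := mul_le_mul_of_nonneg_left h
    (show 0 ≤ 2 * Real.pi * ‖sobolevWeight s ξ‖ * ‖z‖ by positivity)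
  linarith

/-- An element of `H^{s+1}(ℝ)` has a real-valued weak derivative in `H^s(ℝ)`. -/
theorem exists_weakDeriv_memSobolevLine (s : ℝ≥0) {V : Lp ℝ 2 (volume : Measure ℝ)}
    (hV : MemSobolevLine (s + 1) V) :
    ∃ W : Lp ℝ 2 (volume : Measure ℝ), MemSobolevLine s W ∧
      sobolevLineNorm s W ≤ 2 * Real.pi * sobolevLineNorm (s + 1) V ∧
      ∀ g : ℝ → ℝ, ContDiff ℝ ∞ g → HasCompactSupport g →
        ∫ x, V x * deriv g x = -∫ x, W x * g x := by
  rw [memSobolevLine_iff] at hV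
  set A : Lp ℂ 2 (volume : Measure ℝ) := 𝓕 (complexifyL2 V) with hA
  have hAm := Lp.stronglyMeasurable A
  set D : ℝ → ℂ := fun ξ => 2 * Real.pi * Complex.I * ξ * A ξ with hD
  have hDm : AEStronglyMeasurable D volume := by
    refine AEStronglyMeasurable.mul ?_ hAm.aestronglyMeasurable
    exact Continuous.aestronglyMeasurable (by fun_prop)
  have hbound : ∀ᵐ ξ : ℝ, ‖sobolevWeight s ξ * D ξ‖ ≤
      2 * Real.pi * ‖sobolevFourier (s + 1) V ξ‖ :=
    ae_of_all _ fun ξ => norm_two_pi_mul_le s ξ (A ξ)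
  have hwD2 : MemLp (fun ξ => sobolevWeight s ξ * D ξ) 2 volume :=
    hV.of_le_mul ((continuous_sobolevWeight s).aestronglyMeasurable.mul hDm) hbound
  have hD2 : MemLp D 2 volume := hwD2.of_le hDm (ae_of_all _ fun ξ => by
    rw [norm_mul (sobolevWeight s ξ)]
    exact le_mul_of_one_le_left (norm_nonneg _) (one_le_norm_sobolevWeight s ξ))
  -- `G` is the weak derivative as a complex-valued function; testing it against real functions shows
  -- that its imaginary part vanishes.
  set G : Lp ℂ 2 (volume : Measure ℝ) := 𝓕⁻ (hD2.toLp D) with hG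
  have hFG : (𝓕 G : Lp ℂ 2 (volume : Measure ℝ)) = hD2.toLp D :=
    FourierTransform.fourier_fourierInv_eq _
  have hcancel : ∀ ψ : 𝓢(ℝ, ℂ), 𝓕 ((𝓕⁻ ψ : 𝓢(ℝ, ℂ)) : ℝ → ℂ) = ψ := fun ψ => by
    rw [← SchwartzMap.fourier_coe, FourierTransform.fourier_fourierInv_eq]
  have hweak : ∀ φ : 𝓢(ℝ, ℂ), ∫ x, deriv φ x * complexifyL2 V x = -∫ x, φ x * G x := fun φ => by
    have h1 := integral_mul_fourierL2 (𝓕⁻ (SchwartzMap.derivCLM ℂ ℂ φ)) (complexifyL2 V)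
    have h2 := integral_mul_fourierL2 (𝓕⁻ φ) G
    rw [hcancel] at h1 h2
    simp only [SchwartzMap.derivCLM_apply] at h1
    rw [← h1, ← h2, ← integral_neg]
    refine integral_congr_ae ?_
    filter_upwards [hD2.coeFn_toLp] with ξ h
    rw [hFG, h, fourierInv_derivCLM_apply, hD]
    ring
  have hreal : ∀ g : ℝ → ℝ, ContDiff ℝ ∞ g → HasCompactSupport g →
      (∫ x, V x * deriv g x = -∫ x, (G x).re * g x) ∧ ∫ x, g x • (G x).im = 0 := by
    intro g g_smooth g_cpt
    have hg₁ : HasCompactSupport (Complex.ofRealCLM ∘ g) := g_cpt.comp_left rfl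
    have hg₂ : ContDiff ℝ ∞ (Complex.ofRealCLM ∘ g) := by fun_prop
    set φ : 𝓢(ℝ, ℂ) := hg₁.toSchwartzMap hg₂ with hφ
    have hφg : ∀ x, φ x = (g x : ℂ) := fun x => rfl
    have hφ' : ∀ x, deriv φ x = ((deriv g x : ℝ) : ℂ) := fun x =>
      ((g_smooth.differentiable (by simp)) x).hasDerivAt.ofReal_comp.deriv
    have hi : Integrable (fun x => φ x * G x) :=
      MemLp.integrable_mul (p := 2) (q := 2) (φ.memLp 2) (Lp.memLp G)
    have h := hweak φ
    have e1 : ∫ x, deriv φ x * complexifyL2 V x = ((∫ x, V x * deriv g x : ℝ) : ℂ) := by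
      rw [← integral_complex_ofReal]
      refine integral_congr_ae ?_
      filter_upwards [coeFn_complexifyL2 V] with x hx
      rw [hx, hφ']
      push_cast
      ring
    have e2 : ∫ x, (G x).re * g x = (∫ x, φ x * G x).re := by
      rw [← RCLike.re_eq_complex_re, ← integral_re hi]
      congr 1; ext x
      simp [hφg, mul_comm]
    have e3 : ∫ x, g x • (G x).im = (∫ x, φ x * G x).im := by
      rw [← RCLike.im_eq_complex_im, ← integral_im hi]
      congr 1; ext x
      simp [hφg]
    rw [e1] at h
    rw [e2, e3]
    have hr := congrArg Complex.re h
    have hm := congrArg Complex.im h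
    simp only [Complex.ofReal_re, Complex.neg_re, Complex.ofReal_im, Complex.neg_im] at hr hm
    exact ⟨hr, by linarith⟩
  have him : ∀ᵐ x : ℝ, (G x).im = 0 :=
    ae_eq_zero_of_integral_contDiff_smul_eq_zero
      ((Lp.memLp G).im.locallyIntegrable (by norm_num)) fun g h1 h2 => (hreal g h1 h2).2
  have hre : MemLp (fun x => (G x).re) 2 volume := (Lp.memLp G).re
  have hcW : complexifyL2 (hre.toLp _) = G := by
    apply Lp.ext
    filter_upwards [coeFn_complexifyL2 (hre.toLp _), hre.coeFn_toLp, him] with x h1 h2 h3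
    rw [h1, h2]
    exact Complex.ext rfl (by simp [h3])
  have hSF : sobolevFourier s (hre.toLp _) =ᵐ[volume] fun ξ => sobolevWeight s ξ * D ξ := by
    filter_upwards [hD2.coeFn_toLp] with ξ h
    rw [sobolevFourier, hcW, hFG, h, sobolevWeight]
  refine ⟨hre.toLp _, (memSobolevLine_iff _ _).2 (hwD2.ae_eq hSF.symm), ?_, fun g h1 h2 => ?_⟩
  · rw [sobolevLineNorm, eLpNorm_congr_ae hSF]
    have h := eLpNorm_le_mul_eLpNorm_of_ae_le_mul hbound 2
    refine (ENNReal.toReal_mono (ENNReal.mul_lt_top ENNReal.ofReal_lt_top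
      hV.eLpNorm_lt_top).ne h).trans_eq ?_
    rw [ENNReal.toReal_mul, ENNReal.toReal_ofReal (by positivity), sobolevLineNorm]
  · rw [(hreal g h1 h2).1]
    congr 1
    refine integral_congr_ae ?_
    filter_upwards [hre.coeFn_toLp] with x h
    rw [h]

/-! ### Weak derivatives on the interval -/

theorem restrictL2_ae_eq (L : ℝ) (U : Lp ℝ 2 (volume : Measure ℝ)) :
    restrictL2 L U =ᵐ[intervalMeasure L] U :=
  LpToLpRestrictCLM_coeFn ℝ _ U

theorem integrable_intervalMeasure {L : ℝ} (u : Lp ℝ 2 (intervalMeasure L)) :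
    Integrable u (intervalMeasure L) :=
  (Lp.memLp u).integrable (by norm_num)

theorem integrable_intervalMeasure_mul {L : ℝ} (u : Lp ℝ 2 (intervalMeasure L)) {g : ℝ → ℝ}
    (hg : Continuous g) (hc : HasCompactSupport g) :
    Integrable (fun x => u x * g x) (intervalMeasure L) :=
  MemLp.integrable_mul (p := 2) (q := 2) (Lp.memLp u)
    ((hg.memLp_of_hasCompactSupport hc).restrict _)

theorem setIntegral_restrictL2_mul {L : ℝ} (U : Lp ℝ 2 (volume : Measure ℝ)) {g : ℝ → ℝ}
    (hg : tsupport g ⊆ Ioo 0 L) :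
    ∫ x in Ioo 0 L, restrictL2 L U x * g x = ∫ x, U x * g x := by
  have h0 : ∀ x, x ∉ Ioo 0 L → U x * g x = 0 := fun x hx => by
    rw [image_eq_zero_of_notMem_tsupport fun h => hx (hg h), mul_zero]
  rw [← setIntegral_eq_integral_of_forall_compl_eq_zero h0]
  refine integral_congr_ae ?_
  filter_upwards [restrictL2_ae_eq L U] with x hx
  rw [hx]

namespace HasWeakDeriv

variable {L : ℝ} {u₁ u₂ v₁ v₂ : Lp ℝ 2 (intervalMeasure L)}

theorem add (h₁ : HasWeakDeriv u₁ v₁) (h₂ : HasWeakDeriv u₂ v₂) :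
    HasWeakDeriv (u₁ + u₂) (v₁ + v₂) := by
  intro φ hφ hc hs
  have hd : Continuous (deriv φ) := hφ.continuous_deriv (by simp)
  have e1 : ∫ x in Ioo 0 L, (u₁ + u₂ : Lp ℝ 2 (intervalMeasure L)) x * deriv φ x =
      ∫ x in Ioo 0 L, (u₁ x * deriv φ x + u₂ x * deriv φ x) := by
    refine integral_congr_ae ?_
    filter_upwards [Lp.coeFn_add u₁ u₂] with x hx
    rw [hx, Pi.add_apply, add_mul]
  have e2 : ∫ x in Ioo 0 L, (v₁ + v₂ : Lp ℝ 2 (intervalMeasure L)) x * φ x =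
      ∫ x in Ioo 0 L, (v₁ x * φ x + v₂ x * φ x) := by
    refine integral_congr_ae ?_
    filter_upwards [Lp.coeFn_add v₁ v₂] with x hx
    rw [hx, Pi.add_apply, add_mul]
  rw [e1, e2, integral_add (integrable_intervalMeasure_mul u₁ hd hc.deriv)
    (integrable_intervalMeasure_mul u₂ hd hc.deriv),
    integral_add (integrable_intervalMeasure_mul v₁ hφ.continuous hc)
    (integrable_intervalMeasure_mul v₂ hφ.continuous hc), h₁ φ hφ hc hs, h₂ φ hφ hc hs]
  ring

theorem smul (c : ℝ) (h₁ : HasWeakDeriv u₁ v₁) : HasWeakDeriv (c • u₁) (c • v₁) := by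
  intro φ hφ hc hs
  have e1 : ∫ x in Ioo 0 L, (c • u₁ : Lp ℝ 2 (intervalMeasure L)) x * deriv φ x =
      ∫ x in Ioo 0 L, c * (u₁ x * deriv φ x) := by
    refine integral_congr_ae ?_
    filter_upwards [Lp.coeFn_smul c u₁] with x hx
    rw [hx, Pi.smul_apply, smul_eq_mul, mul_assoc]
  have e2 : ∫ x in Ioo 0 L, (c • v₁ : Lp ℝ 2 (intervalMeasure L)) x * φ x =
      ∫ x in Ioo 0 L, c * (v₁ x * φ x) := by
    refine integral_congr_ae ?_
    filter_upwards [Lp.coeFn_smul c v₁] with x hx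
    rw [hx, Pi.smul_apply, smul_eq_mul, mul_assoc]
  rw [e1, e2, integral_const_mul, integral_const_mul, h₁ φ hφ hc hs]
  ring

theorem unique (h₁ : HasWeakDeriv u₁ v₁) (h₂ : HasWeakDeriv u₁ v₂) : v₁ = v₂ := by
  rw [← sub_eq_zero]
  have h : HasWeakDeriv (u₁ + (-1 : ℝ) • u₁) (v₁ + (-1 : ℝ) • v₂) := h₁.add (h₂.smul (-1))
  rw [neg_one_smul, neg_one_smul, add_neg_cancel, ← sub_eq_add_neg] at h
  generalize v₁ - v₂ = v at h
  have hz : ∀ᵐ x, x ∈ Ioo 0 L → v x = 0 := by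
    refine isOpen_Ioo.ae_eq_zero_of_integral_contDiff_smul_eq_zero
      (IntegrableOn.locallyIntegrableOn (integrable_intervalMeasure v)) fun g hg hc hs => ?_
    have e := h g hg hc hs
    have e0 : ∫ x in Ioo 0 L, (0 : Lp ℝ 2 (intervalMeasure L)) x * deriv g x = 0 := by
      refine integral_eq_zero_of_ae ?_
      filter_upwards [Lp.coeFn_zero ℝ 2 (intervalMeasure L)] with x hx
      rw [hx]
      simp
    rw [← setIntegral_eq_integral_of_forall_compl_eq_zero (s := Ioo 0 L)
      fun x hx => by rw [image_eq_zero_of_notMem_tsupport fun h => hx (hs h), zero_smul]]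
    rw [e0] at e
    simp only [smul_eq_mul, mul_comm (g _)]
    linarith
  apply Lp.ext
  filter_upwards [(ae_restrict_iff' measurableSet_Ioo).2 hz,
    Lp.coeFn_zero ℝ 2 (intervalMeasure L)] with x h1 h2
  rw [h1, h2]
  rfl

/-- Weak derivatives restrict from the line to `(0, L)`. -/
theorem of_line {V W : Lp ℝ 2 (volume : Measure ℝ)}
    (h : ∀ g : ℝ → ℝ, ContDiff ℝ ∞ g → HasCompactSupport g →
      ∫ x, V x * deriv g x = -∫ x, W x * g x) :
    HasWeakDeriv (restrictL2 L V) (restrictL2 L W) := by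
  intro φ hφ hc hs
  rw [setIntegral_restrictL2_mul V ((tsupport_deriv_subset (𝕜 := ℝ)).trans hs),
    setIntegral_restrictL2_mul W hs, h φ hφ hc]

end HasWeakDeriv

/-- `w = u v_x` almost everywhere on `(0, L)`, where `v_x` is the weak derivative of `v`: the polarized
form of `IsMulWeakDeriv`. -/
def IsMulWeakDeriv₂ {L : ℝ} (u v w : Lp ℝ 2 (intervalMeasure L)) : Prop :=
  ∃ v' : Lp ℝ 2 (intervalMeasure L), HasWeakDeriv v v' ∧
    ∀ᵐ x ∂intervalMeasure L, w x = u x * v' x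

namespace IsMulWeakDeriv₂

variable {L : ℝ} {u u₁ u₂ v v₁ v₂ w w₁ w₂ : Lp ℝ 2 (intervalMeasure L)}

theorem unique (h₁ : IsMulWeakDeriv₂ u v w₁) (h₂ : IsMulWeakDeriv₂ u v w₂) : w₁ = w₂ := by
  obtain ⟨v', hv', e₁⟩ := h₁
  obtain ⟨v'', hv'', e₂⟩ := h₂
  obtain rfl := hv'.unique hv''
  apply Lp.ext
  filter_upwards [e₁, e₂] with x h1 h2
  rw [h1, h2]

theorem add_left (h₁ : IsMulWeakDeriv₂ u₁ v w₁) (h₂ : IsMulWeakDeriv₂ u₂ v w₂) :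
    IsMulWeakDeriv₂ (u₁ + u₂) v (w₁ + w₂) := by
  obtain ⟨v', hv', e₁⟩ := h₁
  obtain ⟨v'', hv'', e₂⟩ := h₂
  obtain rfl := hv'.unique hv''
  refine ⟨v', hv', ?_⟩
  filter_upwards [e₁, e₂, Lp.coeFn_add u₁ u₂, Lp.coeFn_add w₁ w₂] with x h1 h2 h3 h4
  rw [h3, h4, Pi.add_apply, Pi.add_apply, h1, h2, add_mul]

theorem add_right (h₁ : IsMulWeakDeriv₂ u v₁ w₁) (h₂ : IsMulWeakDeriv₂ u v₂ w₂) :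
    IsMulWeakDeriv₂ u (v₁ + v₂) (w₁ + w₂) := by
  obtain ⟨v', hv', e₁⟩ := h₁
  obtain ⟨v'', hv'', e₂⟩ := h₂
  refine ⟨v' + v'', hv'.add hv'', ?_⟩
  filter_upwards [e₁, e₂, Lp.coeFn_add v' v'', Lp.coeFn_add w₁ w₂] with x h1 h2 h3 h4
  rw [h3, h4, Pi.add_apply, Pi.add_apply, h1, h2, mul_add]

theorem smul_left (c : ℝ) (h : IsMulWeakDeriv₂ u v w) :
    IsMulWeakDeriv₂ (c • u) v (c • w) := by
  obtain ⟨v', hv', e⟩ := h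
  refine ⟨v', hv', ?_⟩
  filter_upwards [e, Lp.coeFn_smul c u, Lp.coeFn_smul c w] with x h1 h2 h3
  rw [h2, h3, Pi.smul_apply, Pi.smul_apply, h1, smul_mul_assoc]

theorem smul_right (c : ℝ) (h : IsMulWeakDeriv₂ u v w) :
    IsMulWeakDeriv₂ u (c • v) (c • w) := by
  obtain ⟨v', hv', e⟩ := h
  refine ⟨c • v', hv'.smul c, ?_⟩
  filter_upwards [e, Lp.coeFn_smul c v', Lp.coeFn_smul c w] with x h1 h2 h3
  rw [h2, h3, Pi.smul_apply, Pi.smul_apply, h1, mul_smul_comm]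

end IsMulWeakDeriv₂

/-! ### The bilinear map `(u, v) ↦ u v_x` on the interval -/

theorem le_mul_csInf {S : Set ℝ} (hS : S.Nonempty) {k x : ℝ} (hk : 0 ≤ k)
    (h : ∀ a ∈ S, x ≤ k * a) : x ≤ k * sInf S := by
  rw [← smul_eq_mul, ← Real.sInf_smul_of_nonneg hk]
  refine le_csInf hS.smul_set ?_
  rintro _ ⟨a, ha, rfl⟩
  exact h a ha

namespace SobolevInterval

variable {s : ℝ≥0} {L : ℝ}

/-- The bound obtained for the bilinear map `(u, v) ↦ u v_x`: the constant of the product estimate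
times the factor `2π` of the differentiation. -/
def mulDerivConst (s : ℝ≥0) : ℝ :=
  2 ^ ((s : ℝ) / 2) * sobolevConst.toReal * (2 * Real.pi)

theorem mulDerivConst_nonneg (s : ℝ≥0) : 0 ≤ mulDerivConst s := by
  unfold mulDerivConst
  positivity

/-- `u v_x` is in `H^s(0, L)`, with a bound by the norms of given extensions of `u` and `v`. -/
theorem exists_isMulWeakDeriv₂_of_extensions {u v : SobolevInterval (s + 1) L}
    {U V : Lp ℝ 2 (volume : Measure ℝ)} (hU : U ∈ extensions u) (hV : V ∈ extensions v) :
    ∃ w : SobolevInterval s L, IsMulWeakDeriv₂ (toL2 u) (toL2 v) (toL2 w) ∧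
      ‖w‖ ≤ mulDerivConst s * sobolevLineNorm (s + 1) U * sobolevLineNorm (s + 1) V := by
  obtain ⟨W, hW, hWn, hweak⟩ := exists_weakDeriv_memSobolevLine s hV.1
  obtain ⟨M, hM, hMeq, hMn⟩ := exists_mul_memSobolevLine s hU.1 hW
  let w : SobolevInterval s L := ⟨restrictL2 L M, M, hM, rfl⟩
  have hw : toL2 w = restrictL2 L M := rfl
  refine ⟨w, ⟨restrictL2 L W, ?_, ?_⟩, ?_⟩
  · rw [← hV.2]
    exact HasWeakDeriv.of_line hweak
  · rw [hw, ← hU.2]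
    filter_upwards [restrictL2_ae_eq L M, restrictL2_ae_eq L U, restrictL2_ae_eq L W,
      ae_restrict_of_ae hMeq] with x h1 h2 h3 h4
    rw [h1, h2, h3, h4]
  · refine (norm_le_of_mem_extensions (U := M) ⟨hM, hw.symm⟩).trans (hMn.trans ?_)
    have h0 : 0 ≤ sobolevLineNorm (s + 1) U := ENNReal.toReal_nonneg
    calc _ ≤ 2 ^ ((s : ℝ) / 2) * sobolevConst.toReal * sobolevLineNorm (s + 1) U *
          (2 * Real.pi * sobolevLineNorm (s + 1) V) :=
        mul_le_mul_of_nonneg_left hWn (by positivity)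
      _ = _ := by rw [mulDerivConst]; ring

theorem exists_isMulWeakDeriv₂ (u v : SobolevInterval (s + 1) L) :
    ∃ w : SobolevInterval s L, IsMulWeakDeriv₂ (toL2 u) (toL2 v) (toL2 w) ∧
      ‖w‖ ≤ mulDerivConst s * ‖u‖ * ‖v‖ := by
  obtain ⟨U₀, hU₀⟩ := u.2
  obtain ⟨V₀, hV₀⟩ := v.2
  obtain ⟨w, hw, -⟩ := exists_isMulWeakDeriv₂_of_extensions (u := u) (v := v) hU₀ hV₀
  refine ⟨w, hw, ?_⟩
  -- Other extensions produce the same `w`, by uniqueness of the weak derivative.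
  have key : ∀ U ∈ extensions u, ∀ V ∈ extensions v,
      ‖w‖ ≤ mulDerivConst s * sobolevLineNorm (s + 1) U * sobolevLineNorm (s + 1) V := by
    intro U hU V hV
    obtain ⟨w', hw', hn⟩ := exists_isMulWeakDeriv₂_of_extensions hU hV
    rwa [toL2_injective (hw.unique hw')]
  have hc := mulDerivConst_nonneg s
  refine le_mul_csInf (extensions_nonempty v) (mul_nonneg hc (norm_nonneg u)) ?_
  rintro _ ⟨V, hV, rfl⟩
  rw [mul_right_comm]
  refine le_mul_csInf (extensions_nonempty u) (mul_nonneg hc ENNReal.toReal_nonneg) ?_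
  rintro _ ⟨U, hU, rfl⟩
  rw [mul_right_comm]
  exact key U hU V hV

variable (s L) in
/-- The bounded bilinear map `(u, v) ↦ u v_x` from `H^{s+1}(0, L) × H^{s+1}(0, L)` to `H^s(0, L)`. -/
def mulDeriv :
    SobolevInterval (s + 1) L →L[ℝ] SobolevInterval (s + 1) L →L[ℝ] SobolevInterval s L :=
  have spec := fun u v : SobolevInterval (s + 1) L => (exists_isMulWeakDeriv₂ u v).choose_spec
  LinearMap.mkContinuous₂
    (LinearMap.mk₂ ℝ (fun u v => (exists_isMulWeakDeriv₂ u v).choose)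
      (fun u₁ u₂ v => toL2_injective <| (spec (u₁ + u₂) v).1.unique <| by
        simpa only [map_add] using (spec u₁ v).1.add_left (spec u₂ v).1)
      (fun c u v => toL2_injective <| (spec (c • u) v).1.unique <| by
        simpa only [map_smul] using (spec u v).1.smul_left c)
      (fun u v₁ v₂ => toL2_injective <| (spec u (v₁ + v₂)).1.unique <| by
        simpa only [map_add] using (spec u v₁).1.add_right (spec u v₂).1)
      (fun c u v => toL2_injective <| (spec u (c • v)).1.unique <| by
        simpa only [map_smul] using (spec u v).1.smul_right c))
    (mulDerivConst s) (fun u v => (spec u v).2)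

theorem isMulWeakDeriv₂_mulDeriv (u v : SobolevInterval (s + 1) L) :
    IsMulWeakDeriv₂ (toL2 u) (toL2 v) (toL2 (mulDeriv s L u v)) :=
  (exists_isMulWeakDeriv₂ u v).choose_spec.1

end SobolevInterval

end

theorem proposition1 (s : ℝ≥0) (T L : ℝ) (hT : 0 < T) (hL : 0 < L) :
    ∃ B : BochnerSobolev 2 T (s + 1) L → BochnerSobolev 1 T s L,
      (∀ y, ∀ᵐ t ∂intervalMeasure T,
        IsMulWeakDeriv (SobolevInterval.toL2 (y t)) (SobolevInterval.toL2 (B y t))) ∧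
      Continuous B ∧
      ∃ K : ℝ, 0 < K ∧ ∀ y z : BochnerSobolev 2 T (s + 1) L,
        ‖B y - B z‖ ≤ K * (‖y‖ + ‖z‖) * ‖y - z‖ := by
  set b := (SobolevInterval.mulDeriv s L).holderL (intervalMeasure T) 2 2 1 with hb
  refine ⟨fun y => b y y, fun y => ?_, b.continuous.clm_apply continuous_id,
    ‖b‖ + 1, by positivity, fun y z => ?_⟩
  · filter_upwards [(SobolevInterval.mulDeriv s L).coeFn_holder (r := 1) y y] with t ht
    have e : b y y = (SobolevInterval.mulDeriv s L).holder 1 y y := rfl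
    rw [e, ht]
    exact SobolevInterval.isMulWeakDeriv₂_mulDeriv (y t) (y t)
  · have e : b y y - b z z = b (y - z) y + b z (y - z) := by
      simp only [map_sub, sub_apply]
      abel
    rw [e]
    have h1 := b.le_opNorm₂ (y - z) y
    have h2 := b.le_opNorm₂ z (y - z)
    have h3 : 0 ≤ (‖y‖ + ‖z‖) * ‖y - z‖ := by positivity
    calc _ ≤ _ := norm_add_le _ _
      _ ≤ ‖b‖ * ‖y - z‖ * ‖y‖ + ‖b‖ * ‖z‖ * ‖y - z‖ := add_le_add h1 h2
      _ ≤ (‖b‖ + 1) * (‖y‖ + ‖z‖) * ‖y - z‖ := by linarith
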